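/- Let $N\ge 1$ and $\beta\ge 0$. A box in $\mathbb{R}^N$ is a bounded open rectangular parallelepiped, i.e. the image under a rigid motion of $(-a_1,a_1)\times\cdots\times(-a_N,a_N)$ with all $a_j>0$. For a box $\Omega$, let $\lambda_1(\Omega)$ be the fundamental Robin eigenvalue: the smallest real $\lambda$ for which there is a function $u\not\equiv 0$, $u\in C^2(\Omega)\cap C^1(\overline\Omega)$, with $$\Delta u+\lambda u=0 \ \text{ in } \Omega,\qquad \beta\,\frac{\partial u}{\partial n}+u=0\ \text{ on every face of } \Omega,$$ where $n$ is the outward unit normal of the face. For $a>0$ let $\mu(a)$ be the smallest positive solution of $\mu\tan(a\mu)=1/\beta$ if $\beta>0$, and $\mu(a)=\pi/(2a)$ if $\beta=0$. Then $\mu$ is strictly decreasing on $(0,\infty)$; every box $\Omega$ with half edge lengths $a_1,\dots,a_N$ has a smallest eigenvalue, and it is given by $$\lambda_1(\Omega)=\sum_{j=1}^N\mu(a_j)^2;$$ and $\lambda_1$ is domain-monotone on boxes: if $\Omega_1\subseteq\Omega_2$ are boxes, then $\lambda_1(\Omega_1)\ge\lambda_1(\Omega_2)$. -/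

import Mathlib

open scoped InnerProductSpace

noncomputable section

/-- An `N`-dimensional box (rectangular parallelepiped) in `ℝ^N`, in arbitrary position and
orientation, given by its centre, an orthonormal frame of edge directions, and the positive half
edge lengths `a_1, …, a_N`. -/
structure RectBox (N : ℕ) where
  center : EuclideanSpace ℝ (Fin N)
  axes : OrthonormalBasis (Fin N) ℝ (EuclideanSpace ℝ (Fin N))
  halfWidth : Fin N → ℝ
  halfWidth_pos : ∀ j, 0 < halfWidth j

namespace RectBox

variable {N : ℕ}

/-- The `j`-th coordinate of the point `x`, relative to the centre and the edge directions. -/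
def coord (B : RectBox N) (j : Fin N) (x : EuclideanSpace ℝ (Fin N)) : ℝ :=
  ⟪B.axes j, x - B.center⟫_ℝ

/-- The box as an open set. -/
def domain (B : RectBox N) : Set (EuclideanSpace ℝ (Fin N)) :=
  {x | ∀ j, -B.halfWidth j < B.coord j x ∧ B.coord j x < B.halfWidth j}

/-- The closed box. -/
def closedDomain (B : RectBox N) : Set (EuclideanSpace ℝ (Fin N)) :=
  {x | ∀ j, -B.halfWidth j ≤ B.coord j x ∧ B.coord j x ≤ B.halfWidth j}

end RectBox

/-- `u` is a classical eigenfunction, with eigenvalue `lam`, of the Robin problem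
`Δ u + lam u = 0` in the box, `β ∂u/∂n + u = 0` on its boundary. Here `u` is `C²` in the open box,
`C¹` up to the boundary, and not identically zero. The boundary condition is imposed on every
face, whose outward unit normal is plus or minus an edge direction; at the points that lie on
several faces it is the limit of the conditions on each of these faces. -/
structure IsRobinEigenfunction {N : ℕ} (β : ℝ) (B : RectBox N) (lam : ℝ)
    (u : EuclideanSpace ℝ (Fin N) → ℝ) : Prop where
  contDiffOn_domain : ContDiffOn ℝ 2 u B.domain
  contDiffOn_closedDomain : ContDiffOn ℝ 1 u B.closedDomain
  nontrivial : ∃ x ∈ B.domain, u x ≠ 0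
  helmholtz : ∀ x ∈ B.domain, Laplacian.laplacian u x + lam * u x = 0
  robin_pos : ∀ j, ∀ x ∈ B.closedDomain, B.coord j x = B.halfWidth j →
    β * fderivWithin ℝ u B.closedDomain x (B.axes j) + u x = 0
  robin_neg : ∀ j, ∀ x ∈ B.closedDomain, B.coord j x = -B.halfWidth j →
    β * fderivWithin ℝ u B.closedDomain x (-B.axes j) + u x = 0

/-- The set of eigenvalues of the Robin problem on a box. -/
def robinEigenvalues {N : ℕ} (β : ℝ) (B : RectBox N) : Set ℝ :=
  {lam | ∃ u, IsRobinEigenfunction β B lam u}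

/-- The fundamental (that is, smallest) Robin eigenvalue of a box. -/
def fundamentalRobinEigenvalue {N : ℕ} (β : ℝ) (B : RectBox N) : ℝ :=
  sInf (robinEigenvalues β B)

/-- The function `μ(β, a)`: for `β > 0` the smallest positive solution `m` of
`m tan (a m) = 1 / β`, and `π / (2 a)` for `β = 0`. -/
def robinMu (β a : ℝ) : ℝ :=
  if β = 0 then Real.pi / (2 * a) else sInf {m : ℝ | 0 < m ∧ m * Real.tan (a * m) = 1 / β}

end

/-! ### The one-dimensional frequency μ. -/

open scoped Topology

/-! Along each edge direction, `cos (μ(a) t)` solves the one-dimensional Robin problem on (-a, a),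
so the product of these cosines is an eigenfunction with eigenvalue `∑ μ(a_j)²`. Nothing smaller is
an eigenvalue: lowering all frequencies slightly gives a product φ that is positive up to the
boundary and a strict supersolution. The maximum principle for u/φ then forces u ≤ 0, and likewise
-u ≤ 0 (`nonpos_of_cosProd`, `nonpos_of_lt`).

For monotonicity, let `c i j` be the inner products of the two edge frames. Inclusion gives `∑ j, |c
i j| a_j ≤ b_i`, hence also `∑ j, (c i j)² a_j ≤ b_i`, and the matrix of squares is doubly
stochastic. Since μ² is decreasing and satisfies Jensen's inequality (`robinMu_sq_le_sum`), each
`μ(b_i)²` is at most the corresponding average of the `μ(a_j)²`; summing over i gives the claim. -/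

open Real in
/-- `robinMu β a` is the root of `β m sin (a m) = cos (a m)` with `0 < a m ≤ π / 2`. -/
theorem robinMu_spec {β a : ℝ} (hβ : 0 ≤ β) (ha : 0 < a) :
    0 < robinMu β a ∧ a * robinMu β a ≤ π / 2 ∧
      β * robinMu β a * sin (a * robinMu β a) = cos (a * robinMu β a) := by
  have hπ := pi_pos
  rcases hβ.eq_or_lt with rfl | hβ
  · have h : a * (π / (2 * a)) = π / 2 := by field_simp
    simp only [robinMu, if_true, h, cos_pi_div_two, zero_mul, le_refl, and_true]
    positivity
  · have hend : a * (π / (2 * a)) = π / 2 := by field_simp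
    have hc : 0 < π / (2 * a) := by positivity
    have hcont : ContinuousOn (fun m : ℝ => β * m * sin (a * m) - cos (a * m))
        (Set.Icc 0 (π / (2 * a))) := by fun_prop
    obtain ⟨m, hm, hroot⟩ := intermediate_value_Ioo hc.le hcont
      (show (0 : ℝ) ∈ Set.Ioo _ _ by
        constructor
        · simp
        · simp only [hend, sin_pi_div_two, cos_pi_div_two]
          simp only [mul_one, sub_zero]; positivity)
    have hroot' : β * m * sin (a * m) = cos (a * m) := by linarith [hroot]
    have ham : a * m < π / 2 := by rw [← hend]; exact mul_lt_mul_of_pos_left hm.2 ha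
    have ham0 : 0 < a * m := mul_pos ha hm.1
    have hcos : 0 < cos (a * m) := cos_pos_of_mem_Ioo ⟨by linarith, ham⟩
    have htan : m * tan (a * m) = 1 / β := by
      rw [tan_eq_sin_div_cos, ← mul_div_assoc, div_eq_div_iff hcos.ne' hβ.ne']
      linarith
    have hmin : IsLeast {m : ℝ | 0 < m ∧ m * tan (a * m) = 1 / β} m := by
      refine ⟨⟨hm.1, htan⟩, ?_⟩
      -- On (0, m] both factors of `k * tan (a * k)` are positive and increasing, so no smaller root
      -- exists.
      rintro k ⟨hk, hk'⟩
      by_contra! hlt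
      have h1 : a * k < a * m := mul_lt_mul_of_pos_left hlt ha
      have h0 : 0 < a * k := mul_pos ha hk
      have h2 : tan (a * k) < tan (a * m) :=
        tan_lt_tan_of_lt_of_lt_pi_div_two (by linarith) ham h1
      have h3 : 0 < tan (a * k) := tan_pos_of_pos_of_lt_pi_div_two h0 (by linarith)
      have : k * tan (a * k) < m * tan (a * m) := by gcongr
      linarith
    have heq : robinMu β a = m := by rw [robinMu, if_neg hβ.ne', hmin.csInf_eq]
    rw [heq]
    exact ⟨hm.1, ham.le, hroot'⟩

theorem robinMu_pos {β a : ℝ} (hβ : 0 ≤ β) (ha : 0 < a) : 0 < robinMu β a :=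
  (robinMu_spec hβ ha).1

open Real in
/-- Below a root, the Robin boundary expression of `cos (m x)` at `x = a` is positive. -/
theorem mul_sin_lt_cos_of_lt {β a b m k : ℝ} (hβ : 0 ≤ β) (hm : 0 < m) (hmk : m ≤ k)
    (ha : 0 < a) (hlt : a * m < b * k) (hk : b * k ≤ π / 2)
    (hroot : β * k * sin (b * k) = cos (b * k)) :
    β * m * sin (a * m) < cos (a * m) := by
  have h0 : 0 < a * m := mul_pos ha hm
  have hs : sin (a * m) ≤ sin (b * k) :=
    sin_le_sin_of_le_of_le_pi_div_two (by linarith) hk hlt.le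
  have hs0 : 0 < sin (a * m) := sin_pos_of_pos_of_lt_pi h0 (by linarith [pi_pos])
  have hc : cos (b * k) < cos (a * m) :=
    cos_lt_cos_of_nonneg_of_le_pi_div_two h0.le hk hlt
  have : β * m * sin (a * m) ≤ β * k * sin (b * k) :=
    mul_le_mul (mul_le_mul_of_nonneg_left hmk hβ) hs hs0.le (mul_nonneg hβ (hm.le.trans hmk))
  linarith

theorem strictAntiOn_robinMu {β : ℝ} (hβ : 0 ≤ β) : StrictAntiOn (robinMu β) (Set.Ioi 0) := by
  intro a (ha : 0 < a) b (hb : 0 < b) hab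
  obtain ⟨ha0, -, har⟩ := robinMu_spec hβ ha
  obtain ⟨hb0, hbp, hbr⟩ := robinMu_spec hβ hb
  by_contra! h
  have hlt : a * robinMu β a < b * robinMu β b := mul_lt_mul hab h ha0 hb.le
  exact (mul_sin_lt_cos_of_lt hβ ha0 h ha hlt hbp hbr).ne har

/-! ### The inverse of μ and Jensen's inequality. -/

open Real in
/-- The inverse function of `robinMu β`. -/
noncomputable def robinHalfWidth (β m : ℝ) : ℝ := (π / 2 - arctan (β * m)) * m⁻¹

open Real in
theorem robinHalfWidth_robinMu {β a : ℝ} (hβ : 0 ≤ β) (ha : 0 < a) :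
    robinHalfWidth β (robinMu β a) = a := by
  obtain ⟨h0, hp, hr⟩ := robinMu_spec hβ ha
  set m := robinMu β a
  have ham : 0 < a * m := mul_pos ha h0
  have hs : 0 < sin (a * m) := sin_pos_of_pos_of_lt_pi ham (by linarith [pi_pos])
  have ht : β * m = tan (π / 2 - a * m) := by
    rw [tan_pi_div_two_sub, tan_eq_sin_div_cos, inv_div, eq_div_iff hs.ne', hr]
  rw [robinHalfWidth, ht, arctan_tan (by linarith [pi_pos]) (by linarith)]
  field_simp
  ring

theorem antitoneOn_inv_Ioi : AntitoneOn (fun x : ℝ => x⁻¹) (Set.Ioi 0) :=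
  fun _ hx _ _ hxy => inv_anti₀ hx hxy

open Real in
theorem antitone_pi_div_two_sub_arctan {β : ℝ} (hβ : 0 ≤ β) :
    Antitone (fun m : ℝ => π / 2 - arctan (β * m)) := by
  intro x y hxy
  have := arctan_mono (mul_le_mul_of_nonneg_left hxy hβ)
  simp only
  linarith

open Real in
theorem strictAntiOn_robinHalfWidth {β : ℝ} (hβ : 0 ≤ β) :
    StrictAntiOn (robinHalfWidth β) (Set.Ioi 0) := by
  intro x (hx : 0 < x) y hy hxy
  have h1 := antitone_pi_div_two_sub_arctan hβ hxy.le
  have h2 : y⁻¹ < x⁻¹ := inv_strictAnti₀ hx hxy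
  have h3 : 0 < y⁻¹ := inv_pos.2 hy
  exact mul_lt_mul' h1 h2 h3.le (by linarith [arctan_lt_pi_div_two (β * x)])

-- Both factors, `π / 2 - arctan (β m)` and `m⁻¹`, are nonnegative, convex and decreasing on the
-- half-line, so their product is convex.
open Real in
theorem convexOn_robinHalfWidth {β : ℝ} (hβ : 0 ≤ β) :
    ConvexOn ℝ (Set.Ioi 0) (robinHalfWidth β) := by
  have hd : ∀ x : ℝ, HasDerivAt (fun m : ℝ => π / 2 - arctan (β * m))
      (-(1 / (1 + (β * x) ^ 2) * (β * 1))) x := fun x =>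
    (((hasDerivAt_id x).const_mul β).arctan).const_sub _
  have h1 : ConvexOn ℝ (Set.Ioi 0) (fun m : ℝ => π / 2 - arctan (β * m)) := by
    refine MonotoneOn.convexOn_of_deriv (convex_Ioi 0)
      (fun x _ => (hd x).continuousAt.continuousWithinAt)
      (fun x _ => (hd x).differentiableAt.differentiableWithinAt) ?_
    rw [interior_Ioi]
    intro x (hx : 0 < x) y _ hxy
    rw [(hd x).deriv, (hd y).deriv]
    gcongr
  have h2 : ConvexOn ℝ (Set.Ioi 0) (fun m : ℝ => m⁻¹) := by
    simpa using convexOn_zpow (𝕜 := ℝ) (-1)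
  exact h1.mul h2 (fun x _ => by linarith [arctan_lt_pi_div_two (β * x)])
    (fun x hx => (inv_pos.2 hx).le)
    ((antitone_pi_div_two_sub_arctan hβ).antitoneOn _ |>.monovaryOn antitoneOn_inv_Ioi)

/-- `robinMu β ^ 2` is convex and decreasing, in the form of Jensen's inequality. -/
theorem robinMu_sq_le_sum {ι : Type*} [Fintype ι] {β b : ℝ} {w a : ι → ℝ} (hβ : 0 ≤ β)
    (hb : 0 < b) (ha : ∀ j, 0 < a j) (hw : ∀ j, 0 ≤ w j) (hw1 : ∑ j, w j = 1)
    (hle : ∑ j, w j * a j ≤ b) :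
    robinMu β b ^ 2 ≤ ∑ j, w j * robinMu β (a j) ^ 2 := by
  have hmu := fun j => robinMu_pos hβ (ha j)
  have hJ := (convexOn_robinHalfWidth hβ).map_sum_le (t := Finset.univ) (w := w)
    (p := fun j => robinMu β (a j)) (fun j _ => hw j) hw1 (fun j _ => hmu j)
  have hS : ∑ j, w j • robinMu β (a j) ∈ Set.Ioi (0 : ℝ) :=
    (convex_Ioi (0 : ℝ)).sum_mem (fun j _ => hw j) hw1 (fun j _ => hmu j)
  simp only [robinHalfWidth_robinMu hβ (ha _), smul_eq_mul] at hJ hS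
  -- Jensen for the inverse function, which is decreasing, passes to μ itself; squaring is then
  -- handled by convexity of the square.
  have h1 : robinMu β b ≤ ∑ j, w j * robinMu β (a j) := by
    refine ((strictAntiOn_robinHalfWidth hβ).le_iff_ge hS (robinMu_pos hβ hb)).1 ?_
    rw [robinHalfWidth_robinMu hβ hb]
    exact hJ.trans hle
  have h2 := (even_two.convexOn_pow (𝕜 := ℝ)).map_sum_le (t := Finset.univ) (w := w)
    (p := fun j => robinMu β (a j)) (fun j _ => hw j) hw1 (fun j _ => Set.mem_univ _)
  simp only [smul_eq_mul] at h2
  exact (pow_le_pow_left₀ (robinMu_pos hβ hb).le h1 2).trans h2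

/-! ### Second derivatives at a minimum. -/

/-- The Laplacian as a sum of second derivatives along the lines of an orthonormal frame. -/
theorem laplacian_eq_sum_deriv_deriv {ι E : Type*} [Fintype ι] [NormedAddCommGroup E]
    [InnerProductSpace ℝ E] [FiniteDimensional ℝ E] (e : OrthonormalBasis ι ℝ E) {f : E → ℝ}
    {x : E} (hf : ContDiffAt ℝ 2 f x) :
    Laplacian.laplacian f x = ∑ j, deriv (deriv fun t : ℝ => f (x + t • e j)) 0 := by
  rw [InnerProductSpace.laplacian_eq_iteratedFDeriv_orthonormalBasis f e]
  refine Finset.sum_congr rfl fun j _ => ?_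
  have hline : ∀ t : ℝ, HasDerivAt (fun t : ℝ => x + t • e j) (e j) t := fun t => by
    simpa using ((hasDerivAt_id t).smul_const (e j)).const_add x
  have hd : ∀ᶠ y in 𝓝 x, DifferentiableAt ℝ f y :=
    (hf.eventually (by simp)).mono fun y hy => hy.differentiableAt (by simp)
  have hx0 : x + (0 : ℝ) • e j = x := by simp
  have ht : Filter.Tendsto (fun t : ℝ => x + t • e j) (𝓝 0) (𝓝 x) := by
    simpa only [hx0] using (hline 0).continuousAt.tendsto
  have h1 : deriv (fun t : ℝ => f (x + t • e j)) =ᶠ[𝓝 0]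
      fun t => fderiv ℝ f (x + t • e j) (e j) :=
    (ht.eventually hd).mono fun t h => (h.hasFDerivAt.comp_hasDerivAt t (hline t)).deriv
  have hd2 : HasFDerivAt (fderiv ℝ f) (fderiv ℝ (fderiv ℝ f) x) (x + (0 : ℝ) • e j) := by
    rw [hx0]
    exact ((hf.fderiv_right (m := 1) (by norm_num)).differentiableAt (by simp)).hasFDerivAt
  have h2 : HasDerivAt (fun t : ℝ => fderiv ℝ f (x + t • e j))
      (fderiv ℝ (fderiv ℝ f) x (e j)) 0 := hd2.comp_hasDerivAt 0 (hline 0)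
  have h3 : HasDerivAt (fun t : ℝ => fderiv ℝ f (x + t • e j) (e j))
      (fderiv ℝ (fderiv ℝ f) x (e j) (e j)) 0 :=
    ((ContinuousLinearMap.apply ℝ ℝ (e j)).hasFDerivAt).comp_hasDerivAt 0 h2
  rw [h1.deriv_eq, iteratedFDeriv_two_apply, h3.deriv]
  rfl

/-- A negative second derivative would make the point a local maximum too, so `f` would be locally
constant and its second derivative zero. -/
theorem IsLocalMin.deriv_deriv_nonneg {f : ℝ → ℝ} {x : ℝ} (h : IsLocalMin f x)
    (hf : ContinuousAt f x) : 0 ≤ deriv (deriv f) x := by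
  by_contra! hlt
  have hmax := isLocalMax_of_deriv_deriv_neg hlt h.deriv_eq_zero hf
  have hc : f =ᶠ[𝓝 x] fun _ => f x := by
    filter_upwards [h, hmax] with y h1 h2 using le_antisymm h2 h1
  have := hc.deriv.deriv_eq
  simp only [deriv_const', deriv_const] at this
  linarith

theorem IsLocalMin.laplacian_nonneg {E : Type*} [NormedAddCommGroup E]
    [InnerProductSpace ℝ E] [FiniteDimensional ℝ E] {f : E → ℝ}
    {x : E} (h : IsLocalMin f x) (hf : ContDiffAt ℝ 2 f x) :
    0 ≤ Laplacian.laplacian f x := by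
  rw [laplacian_eq_sum_deriv_deriv (stdOrthonormalBasis ℝ E) hf]
  refine Finset.sum_nonneg fun j _ => ?_
  have hx0 : x + (0 : ℝ) • stdOrthonormalBasis ℝ E j = x := by simp
  have hc : ContinuousAt (fun t : ℝ => x + t • stdOrthonormalBasis ℝ E j) 0 := by fun_prop
  refine IsLocalMin.deriv_deriv_nonneg ?_ ?_
  · refine IsMinFilter.comp_tendsto (l := 𝓝 x) (g := fun t : ℝ => x + t • stdOrthonormalBasis ℝ E j)
      (f := f) ?_ ?_
    · simpa [IsLocalMin, hx0] using h
    · simpa only [hx0] using hc.tendsto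
  · exact ContinuousAt.comp (g := f) (by rw [hx0]; exact hf.continuousAt) hc

/-! ### Boxes and products of cosines. -/

namespace RectBox

variable {N : ℕ} (B : RectBox N)

theorem coord_add_smul_axes (j k : Fin N) (x : EuclideanSpace ℝ (Fin N)) (t : ℝ) :
    B.coord j (x + t • B.axes k) = B.coord j x + if j = k then t else 0 := by
  rw [coord, coord, add_sub_right_comm, inner_add_right, inner_smul_right,
    B.axes.inner_eq_ite, mul_ite, mul_one, mul_zero]

theorem contDiff_coord {n : WithTop ℕ∞} (j : Fin N) : ContDiff ℝ n (B.coord j) := by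
  exact contDiff_const.inner ℝ (contDiff_id.sub contDiff_const)

theorem continuous_coord (j : Fin N) : Continuous (B.coord j) :=
  (B.contDiff_coord (n := 0) j).continuous

theorem domain_subset_closedDomain : B.domain ⊆ B.closedDomain :=
  fun _ hx j => ⟨(hx j).1.le, (hx j).2.le⟩

theorem isOpen_domain : IsOpen B.domain := by
  simp only [domain, Set.ofPred_forall]
  exact isOpen_iInter_of_finite fun j =>
    (isOpen_lt continuous_const (B.continuous_coord j)).inter
      (isOpen_lt (B.continuous_coord j) continuous_const)

theorem center_mem_domain : B.center ∈ B.domain := fun j => by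
  simp [coord, B.halfWidth_pos j]

theorem isCompact_closedDomain : IsCompact B.closedDomain := by
  refine Metric.isCompact_of_isClosed_isBounded ?_ ?_
  · simp only [closedDomain, Set.ofPred_forall]
    exact isClosed_iInter fun j =>
      (isClosed_le continuous_const (B.continuous_coord j)).inter
        (isClosed_le (B.continuous_coord j) continuous_const)
  · refine (Metric.isBounded_closedBall (x := B.center)
      (r := √(∑ j, B.halfWidth j ^ 2))).subset fun x hx => ?_
    rw [Metric.mem_closedBall, dist_eq_norm]
    refine Real.le_sqrt_of_sq_le ?_
    rw [← B.axes.sum_sq_inner_right]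
    exact Finset.sum_le_sum fun j _ => sq_le_sq' (hx j).1 (hx j).2

theorem coord_combo (j : Fin N) (x y : EuclideanSpace ℝ (Fin N)) {s t : ℝ} (h : s + t = 1) :
    B.coord j (s • x + t • y) = s * B.coord j x + t * B.coord j y := by
  have : s • x + t • y - B.center = s • (x - B.center) + t • (y - B.center) := by
    obtain rfl : t = 1 - s := by linarith
    module
  rw [coord, this, inner_add_right, inner_smul_right, inner_smul_right, coord, coord]

theorem convex_closedDomain : Convex ℝ B.closedDomain := by
  intro x hx y hy s t hs ht hst j
  rw [B.coord_combo j x y hst]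
  obtain rfl : t = 1 - s := by linarith
  have h1 := hx j
  have h2 := hy j
  constructor <;> nlinarith

theorem uniqueDiffOn_closedDomain : UniqueDiffOn ℝ B.closedDomain :=
  uniqueDiffOn_convex B.convex_closedDomain
    ⟨B.center, interior_maximal B.domain_subset_closedDomain B.isOpen_domain B.center_mem_domain⟩

/-- The product of cosines with frequencies `ν` along the edge directions. -/
noncomputable def cosProd (ν : Fin N → ℝ) (x : EuclideanSpace ℝ (Fin N)) : ℝ :=
  ∏ j, Real.cos (ν j * B.coord j x)

variable {B}

theorem contDiff_cosProd (ν : Fin N → ℝ) {n : WithTop ℕ∞} : ContDiff ℝ n (B.cosProd ν) :=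
  contDiff_prod fun j _ => Real.contDiff_cos.comp (contDiff_const.mul (B.contDiff_coord j))

theorem cosProd_add_smul_axes (ν : Fin N → ℝ) (j : Fin N) (x : EuclideanSpace ℝ (Fin N)) (t : ℝ) :
    B.cosProd ν (x + t • B.axes j) = Real.cos (ν j * (B.coord j x + t)) *
      ∏ k ∈ Finset.univ.erase j, Real.cos (ν k * B.coord k x) := by
  rw [cosProd, ← Finset.mul_prod_erase _ _ (Finset.mem_univ j)]
  congr 1
  · simp [coord_add_smul_axes]
  · refine Finset.prod_congr rfl fun k hk => ?_
    rw [coord_add_smul_axes, if_neg (Finset.ne_of_mem_erase hk), add_zero]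

theorem cosProd_eq (ν : Fin N → ℝ) (j : Fin N) (x : EuclideanSpace ℝ (Fin N)) :
    B.cosProd ν x = Real.cos (ν j * B.coord j x) *
      ∏ k ∈ Finset.univ.erase j, Real.cos (ν k * B.coord k x) := by
  simpa using cosProd_add_smul_axes ν j x 0

theorem hasDerivAt_mul_add (m c t : ℝ) : HasDerivAt (fun t : ℝ => m * (c + t)) m t := by
  simpa using ((hasDerivAt_id t).const_add c).const_mul m

theorem fderiv_cosProd_axes (ν : Fin N → ℝ) (j : Fin N) (x : EuclideanSpace ℝ (Fin N)) :
    fderiv ℝ (B.cosProd ν) x (B.axes j) = -(ν j * Real.sin (ν j * B.coord j x)) *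
      ∏ k ∈ Finset.univ.erase j, Real.cos (ν k * B.coord k x) := by
  have hd : DifferentiableAt ℝ (B.cosProd ν) x :=
    (contDiff_cosProd ν (n := 1)).differentiable (by simp) x
  have h := hd.hasFDerivAt.hasLineDerivAt (B.axes j)
  have h' := ((hasDerivAt_mul_add (ν j) (B.coord j x) 0).cos.mul_const
    (∏ k ∈ Finset.univ.erase j, Real.cos (ν k * B.coord k x)))
  simp only [HasLineDerivAt, cosProd_add_smul_axes] at h
  rw [h.unique h', add_zero]
  ring

theorem laplacian_cosProd (ν : Fin N → ℝ) (x : EuclideanSpace ℝ (Fin N)) :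
    Laplacian.laplacian (B.cosProd ν) x = -(∑ j, ν j ^ 2) * B.cosProd ν x := by
  rw [laplacian_eq_sum_deriv_deriv B.axes (contDiff_cosProd ν).contDiffAt, ← Finset.sum_neg_distrib,
    Finset.sum_mul]
  refine Finset.sum_congr rfl fun j _ => ?_
  simp only [cosProd_add_smul_axes]
  have h1 : deriv (fun t : ℝ => Real.cos (ν j * (B.coord j x + t)) *
      ∏ k ∈ Finset.univ.erase j, Real.cos (ν k * B.coord k x)) = fun t =>
      -Real.sin (ν j * (B.coord j x + t)) * ν j *
        ∏ k ∈ Finset.univ.erase j, Real.cos (ν k * B.coord k x) :=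
    funext fun t => ((hasDerivAt_mul_add (ν j) (B.coord j x) t).cos.mul_const _).deriv
  have h2 := ((hasDerivAt_mul_add (ν j) (B.coord j x) 0).sin.neg.mul_const (ν j)).mul_const
    (∏ k ∈ Finset.univ.erase j, Real.cos (ν k * B.coord k x))
  rw [h1, cosProd_eq ν j]
  refine h2.deriv.trans ?_
  rw [add_zero]
  ring

theorem cos_pos_of_abs_le {m a c : ℝ} (hm : 0 < m) (ha : a * m < Real.pi / 2) (h1 : -a ≤ c)
    (h2 : c ≤ a) : 0 < Real.cos (m * c) :=
  Real.cos_pos_of_mem_Ioo ⟨by nlinarith, by nlinarith⟩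

theorem cosProd_pos {ν : Fin N → ℝ} (hν : ∀ j, 0 < ν j)
    (hlt : ∀ j, B.halfWidth j * ν j < Real.pi / 2) {x : EuclideanSpace ℝ (Fin N)}
    (hx : x ∈ B.closedDomain) : 0 < B.cosProd ν x :=
  Finset.prod_pos fun j _ => cos_pos_of_abs_le (hν j) (hlt j) (hx j).1 (hx j).2

theorem exists_face_of_notMem_domain {x : EuclideanSpace ℝ (Fin N)} (hx : x ∈ B.closedDomain)
    (hx' : x ∉ B.domain) : ∃ j, B.coord j x = B.halfWidth j ∨ B.coord j x = -B.halfWidth j := by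
  by_contra! h
  exact hx' fun j => ⟨lt_of_le_of_ne (hx j).1 (h j).2.symm, lt_of_le_of_ne (hx j).2 (h j).1⟩

/-- A `C¹` function on the closed box with a minimum on a face has nonpositive outward normal
derivative there. -/
theorem mul_fderivWithin_axes_nonpos {g : EuclideanSpace ℝ (Fin N) → ℝ}
    {g' : EuclideanSpace ℝ (Fin N) →L[ℝ] ℝ} {x : EuclideanSpace ℝ (Fin N)} {j : Fin N} {σ : ℝ}
    (hx : x ∈ B.closedDomain)
    (hface : B.coord j x = σ * B.halfWidth j) (hmin : IsMinOn g B.closedDomain x)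
    (hg : HasFDerivWithinAt g g' B.closedDomain x) : g' (σ • B.axes j) ≤ 0 := by
  have ha := B.halfWidth_pos j
  -- Moving inward from the face to the mid-plane `coord j = 0` stays in the closed box.
  have hmem : x + (-(σ * B.halfWidth j)) • B.axes j ∈ B.closedDomain := by
    intro k
    rw [coord_add_smul_axes]
    split_ifs with h
    · subst h
      rw [hface]
      constructor <;> linarith
    · simpa using hx k
  have h := hmin.localize.hasFDerivWithinAt_nonneg hg
    (mem_posTangentConeAt_of_segment_subset
      (y := (-(σ * B.halfWidth j)) • B.axes j)
      (B.convex_closedDomain.segment_subset hx hmem))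
  rw [map_smul, smul_eq_mul] at h ⊢
  nlinarith

end RectBox

namespace RectBox

variable {N : ℕ} {B : RectBox N}

/-- Cosine is even, so opposite faces give the same factor. It vanishes at the root μ and is
positive for lower frequencies. -/
theorem robin_cosProd (β : ℝ) (ν : Fin N → ℝ) {j : Fin N} {x : EuclideanSpace ℝ (Fin N)} {σ : ℝ}
    (hσ : σ = 1 ∨ σ = -1) (hface : B.coord j x = σ * B.halfWidth j) :
    β * fderiv ℝ (B.cosProd ν) x (σ • B.axes j) + B.cosProd ν x =
      (Real.cos (B.halfWidth j * ν j) - β * ν j * Real.sin (B.halfWidth j * ν j)) *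
        ∏ k ∈ Finset.univ.erase j, Real.cos (ν k * B.coord k x) := by
  rw [map_smul, smul_eq_mul, fderiv_cosProd_axes, cosProd_eq ν j, hface, mul_comm (B.halfWidth j)]
  rcases hσ with rfl | rfl
  · simp only [one_mul]
    ring
  · simp only [neg_mul, one_mul, mul_neg, Real.sin_neg, Real.cos_neg]
    ring

end RectBox

/-! ### The smallest eigenvalue. -/

open RectBox

variable {N : ℕ} {B : RectBox N} {β lam : ℝ} {u : EuclideanSpace ℝ (Fin N) → ℝ}

theorem isRobinEigenfunction_cosProd (hβ : 0 ≤ β) (B : RectBox N) :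
    IsRobinEigenfunction β B (∑ j, robinMu β (B.halfWidth j) ^ 2)
      (B.cosProd fun j => robinMu β (B.halfWidth j)) := by
  have hface : ∀ (σ : ℝ) (j : Fin N), ∀ x ∈ B.closedDomain, (σ = 1 ∨ σ = -1) →
      B.coord j x = σ * B.halfWidth j →
      β * fderivWithin ℝ (B.cosProd fun j => robinMu β (B.halfWidth j)) B.closedDomain x
        (σ • B.axes j) + B.cosProd (fun j => robinMu β (B.halfWidth j)) x = 0 := by
    intro σ j x hx hσ hc
    rw [((contDiff_cosProd _ (n := 1)).differentiable (by simp) x).fderivWithin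
      (B.uniqueDiffOn_closedDomain x hx), robin_cosProd β _ hσ hc,
      (robinMu_spec hβ (B.halfWidth_pos j)).2.2, sub_self, zero_mul]
  refine ⟨(contDiff_cosProd _).contDiffOn, (contDiff_cosProd _).contDiffOn,
    ⟨B.center, B.center_mem_domain, ?_⟩, fun x _ => ?_, fun j x hx hc => ?_, fun j x hx hc => ?_⟩
  · simp [cosProd, coord]
  · rw [laplacian_cosProd]
    ring
  · simpa using hface 1 j x hx (Or.inl rfl) (by simpa using hc)
  · simpa using hface (-1) j x hx (Or.inr rfl) (by simpa using hc)

theorem IsRobinEigenfunction.neg (h : IsRobinEigenfunction β B lam u) :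
    IsRobinEigenfunction β B lam (-u) := by
  have hL : ∀ x ∈ B.domain, Laplacian.laplacian (-u) x = -Laplacian.laplacian u x := fun x hx => by
    simpa using InnerProductSpace.laplacian_smul (-1 : ℝ)
      (h.contDiffOn_domain.contDiffAt (B.isOpen_domain.mem_nhds hx))
  refine ⟨h.1.neg, h.2.neg, ?_, fun x hx => ?_, fun j x hx hc => ?_, fun j x hx hc => ?_⟩
  · obtain ⟨x, hx, hne⟩ := h.3
    exact ⟨x, hx, by simpa using hne⟩
  · have := h.4 x hx
    rw [hL x hx, Pi.neg_apply]
    linarith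
  · have := h.5 j x hx hc
    rw [fderivWithin_neg (B.uniqueDiffOn_closedDomain x hx)]
    simp only [_root_.neg_apply, Pi.neg_apply]
    linarith
  · have := h.6 j x hx hc
    rw [fderivWithin_neg (B.uniqueDiffOn_closedDomain x hx)]
    simp only [_root_.neg_apply, Pi.neg_apply]
    linarith

theorem IsRobinEigenfunction.robin (h : IsRobinEigenfunction β B lam u) {j : Fin N}
    {x : EuclideanSpace ℝ (Fin N)} {σ : ℝ} (hσ : σ = 1 ∨ σ = -1) (hx : x ∈ B.closedDomain)
    (hface : B.coord j x = σ * B.halfWidth j) :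
    β * fderivWithin ℝ u B.closedDomain x (σ • B.axes j) + u x = 0 := by
  rcases hσ with rfl | rfl
  · simpa using h.robin_pos j x hx (by simpa using hface)
  · simpa using h.robin_neg j x hx (by simpa using hface)

/-- Maximum principle: comparison with a strict supersolution that is a product of cosines. -/
theorem IsRobinEigenfunction.nonpos_of_cosProd (hβ : 0 ≤ β) (h : IsRobinEigenfunction β B lam u)
    {ν : Fin N → ℝ} (hν : ∀ j, 0 < ν j) (hπ : ∀ j, B.halfWidth j * ν j < Real.pi / 2)
    (hrobin : ∀ j, β * ν j * Real.sin (B.halfWidth j * ν j) < Real.cos (B.halfWidth j * ν j))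
    (hlam : lam < ∑ j, ν j ^ 2) {y : EuclideanSpace ℝ (Fin N)} (hy : y ∈ B.closedDomain) :
    u y ≤ 0 := by
  by_contra! hpos
  set φ := B.cosProd ν with hφ
  have hφpos : ∀ x ∈ B.closedDomain, 0 < φ x := fun x hx => cosProd_pos hν hπ hx
  have hφc : ContDiff ℝ 2 φ := contDiff_cosProd ν
  obtain ⟨x, hx, hmax⟩ := B.isCompact_closedDomain.exists_isMaxOn ⟨y, hy⟩
    (h.contDiffOn_closedDomain.continuousOn.div hφc.continuous.continuousOn
      fun x hx => (hφpos x hx).ne')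
  have hφx := hφpos x hx
  set M : ℝ := u x / φ x with hM
  have hMφ : M * φ x = u x := div_mul_cancel₀ _ hφx.ne'
  have hM0 : 0 < M := (div_pos hpos (hφpos y hy)).trans_le (hmax hy)
  -- `M` is the least multiple with `M φ ≥ u`; the two functions touch at `x`.
  set g : EuclideanSpace ℝ (Fin N) → ℝ := M • φ + (-1 : ℝ) • u with hg
  have hgx : g x = 0 := by simp [hg, hMφ]
  have hmin : IsMinOn g B.closedDomain x := by
    intro z hz
    have h1 : u z / φ z ≤ M := hmax hz
    rw [div_le_iff₀ (hφpos z hz)] at h1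
    simp only [Set.mem_ofPred_eq, hgx]
    simp only [hg, Pi.add_apply, Pi.smul_apply, smul_eq_mul]
    linarith
  by_cases hxd : x ∈ B.domain
  · have hnhds := B.isOpen_domain.mem_nhds hxd
    have hu : ContDiffAt ℝ 2 u x := h.contDiffOn_domain.contDiffAt hnhds
    have hloc : IsLocalMin g x :=
      hmin.isLocalMin (Filter.mem_of_superset hnhds B.domain_subset_closedDomain)
    have hMc : ContDiffAt ℝ 2 (M • φ) x := contDiffAt_const.smul hφc.contDiffAt
    have huc : ContDiffAt ℝ 2 ((-1 : ℝ) • u) x := contDiffAt_const.smul hu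
    have hL := hloc.laplacian_nonneg (hMc.add huc)
    rw [hg, hMc.laplacian_add huc,
      InnerProductSpace.laplacian_smul _ hφc.contDiffAt, InnerProductSpace.laplacian_smul _ hu,
      laplacian_cosProd, smul_eq_mul, smul_eq_mul] at hL
    have hH := h.helmholtz x hxd
    rw [← hMφ] at hH
    have : 0 < (∑ j, ν j ^ 2 - lam) * (M * φ x) :=
      mul_pos (sub_pos.2 hlam) (mul_pos hM0 hφx)
    -- At `x` the Laplacian of `g` equals `(lam - ∑ ν j ^ 2) * (M * φ x) < 0`, against `hL`.
    linarith
  · obtain ⟨j, hj⟩ := exists_face_of_notMem_domain hx hxd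
    obtain ⟨σ, hσ, hface⟩ : ∃ σ : ℝ, (σ = 1 ∨ σ = -1) ∧ B.coord j x = σ * B.halfWidth j := by
      rcases hj with hj | hj
      · exact ⟨1, Or.inl rfl, by simpa using hj⟩
      · exact ⟨-1, Or.inr rfl, by simpa using hj⟩
    have hu := (h.contDiffOn_closedDomain.differentiableOn (by simp) x hx).hasFDerivWithinAt
    have hφ' := (hφc.differentiable (by simp) x).hasFDerivAt.hasFDerivWithinAt
      (s := B.closedDomain)
    have hn := mul_fderivWithin_axes_nonpos hx hface hmin
      ((hφ'.const_smul M).add (hu.const_smul (-1 : ℝ)))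
    simp only [add_apply, smul_apply, smul_eq_mul] at hn
    have h1 := h.robin hσ hx hface
    have h2 : 0 < β * fderiv ℝ φ x (σ • B.axes j) + φ x := by
      rw [hφ, robin_cosProd β ν hσ hface]
      exact mul_pos (sub_pos.2 (hrobin j)) (Finset.prod_pos fun k _ =>
        cos_pos_of_abs_le (hν k) (hπ k) (hx k).1 (hx k).2)
    have h3 := mul_nonpos_of_nonneg_of_nonpos hβ hn
    have h4 := mul_pos hM0 h2
    -- As `g x = 0`, the Robin expression of `g` is nonpositive by `h3`; yet it equals `M` times
    -- that of φ, which is positive.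
    linarith

/-- Scaling the frequencies by `s < 1` makes the boundary inequality strict and, even for β = 0,
keeps the product positive on the faces; `s` near 1 keeps the sum of squares above `lam`. -/
theorem IsRobinEigenfunction.nonpos_of_lt (hβ : 0 ≤ β) (h : IsRobinEigenfunction β B lam u)
    (hlam : lam < ∑ j, robinMu β (B.halfWidth j) ^ 2) {y : EuclideanSpace ℝ (Fin N)}
    (hy : y ∈ B.closedDomain) : u y ≤ 0 := by
  have hcont : Filter.Tendsto (fun s : ℝ => ∑ j, (s * robinMu β (B.halfWidth j)) ^ 2) (𝓝[<] 1)
      (𝓝 (∑ j, robinMu β (B.halfWidth j) ^ 2)) := by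
    have : Continuous fun s : ℝ => ∑ j, (s * robinMu β (B.halfWidth j)) ^ 2 := by fun_prop
    simpa using (this.tendsto 1).mono_left nhdsWithin_le_nhds
  obtain ⟨s, hs, hs0, hs1⟩ := ((hcont.eventually_const_lt hlam).and
    (Ioo_mem_nhdsLT (zero_lt_one' ℝ))).exists
  have hmu := fun j => robinMu_spec hβ (B.halfWidth_pos j)
  have hlt : ∀ j, s * robinMu β (B.halfWidth j) < robinMu β (B.halfWidth j) := fun j =>
    mul_lt_of_lt_one_left (hmu j).1 hs1
  have hlt' : ∀ j, B.halfWidth j * (s * robinMu β (B.halfWidth j)) <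
      B.halfWidth j * robinMu β (B.halfWidth j) := fun j =>
    mul_lt_mul_of_pos_left (hlt j) (B.halfWidth_pos j)
  exact h.nonpos_of_cosProd hβ (fun j => mul_pos hs0 (hmu j).1)
    (fun j => (hlt' j).trans_le (hmu j).2.1)
    (fun j => mul_sin_lt_cos_of_lt hβ (mul_pos hs0 (hmu j).1) (hlt j).le (B.halfWidth_pos j)
      (hlt' j) (hmu j).2.1 (hmu j).2.2) hs hy

theorem isLeast_robinEigenvalues (hβ : 0 ≤ β) (B : RectBox N) :
    IsLeast (robinEigenvalues β B) (∑ j, robinMu β (B.halfWidth j) ^ 2) := by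
  refine ⟨⟨_, isRobinEigenfunction_cosProd hβ B⟩, ?_⟩
  rintro lam ⟨u, hu⟩
  by_contra! hlt
  obtain ⟨x, hx, hne⟩ := hu.nontrivial
  have hx' := B.domain_subset_closedDomain hx
  have h1 := hu.nonpos_of_lt hβ hlt hx'
  have h2 := hu.neg.nonpos_of_lt hβ hlt hx'
  rw [Pi.neg_apply] at h2
  exact hne (by linarith)

theorem fundamentalRobinEigenvalue_eq (hβ : 0 ≤ β) (B : RectBox N) :
    fundamentalRobinEigenvalue β B = ∑ j, robinMu β (B.halfWidth j) ^ 2 :=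
  (isLeast_robinEigenvalues hβ B).csInf_eq

/-! ### Domain monotonicity. -/

namespace RectBox

/-- Support function inequality for an inclusion of boxes. -/
theorem sum_abs_inner_mul_halfWidth_le {B₁ B₂ : RectBox N} (h : B₁.domain ⊆ B₂.domain)
    (i : Fin N) : ∑ j, |⟪B₂.axes i, B₁.axes j⟫_ℝ| * B₁.halfWidth j ≤ B₂.halfWidth i := by
  set S := ∑ j, |⟪B₂.axes i, B₁.axes j⟫_ℝ| * B₁.halfWidth j with hS
  -- The offset from the centre of the first box to a point of its closure farthest in direction
  -- `B₂.axes i`.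
  let w : EuclideanSpace ℝ (Fin N) :=
    ∑ j, (SignType.sign ⟪B₂.axes i, B₁.axes j⟫_ℝ * B₁.halfWidth j : ℝ) • B₁.axes j
  have hw : ⟪B₂.axes i, w⟫_ℝ = S := by
    simp only [w, inner_sum, inner_smul_right, hS]
    refine Finset.sum_congr rfl fun j _ => ?_
    rw [← sign_mul_self]
    ring
  have hmem : ∀ t : ℝ, |t| < 1 → B₁.center + t • w ∈ B₁.domain := by
    intro t ht j
    have hc : B₁.coord j (B₁.center + t • w) =
        t * (SignType.sign ⟪B₂.axes i, B₁.axes j⟫_ℝ * B₁.halfWidth j) := by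
      rw [coord, add_sub_cancel_left, inner_smul_right]
      congr 1
      simp [w, inner_sum, inner_smul_right, B₁.axes.inner_eq_ite]
    rw [hc, ← abs_lt, abs_mul, abs_mul, abs_of_pos (B₁.halfWidth_pos j)]
    have hsign : |((SignType.sign ⟪B₂.axes i, B₁.axes j⟫_ℝ : SignType) : ℝ)| ≤ 1 := by
      rcases SignType.trichotomy (SignType.sign ⟪B₂.axes i, B₁.axes j⟫_ℝ) with h | h | h <;>
        simp [h]
    have ha := B₁.halfWidth_pos j
    calc _ ≤ |t| * (1 * B₁.halfWidth j) := by gcongr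
      _ < 1 * (1 * B₁.halfWidth j) := by gcongr
      _ = _ := by ring
  have hcoord : ∀ t : ℝ, B₂.coord i (B₁.center + t • w) = B₂.coord i B₁.center + t * S := by
    intro t
    rw [coord, add_sub_right_comm, inner_add_right, inner_smul_right, hw, coord]
  -- Using both `t` and `-t` cancels the unknown offset between the centres; `t < 1` is needed
  -- because the box is open.
  have key : ∀ t ∈ Set.Ioo (0 : ℝ) 1, t * S ≤ B₂.halfWidth i := by
    rintro t ⟨h0, h1⟩
    have hp := (h (hmem t (by rwa [abs_of_pos h0])) i).2
    have hm := (h (hmem (-t) (by rwa [abs_neg, abs_of_pos h0])) i).1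
    rw [hcoord] at hp hm
    linarith
  have hlim : Filter.Tendsto (fun t : ℝ => t * S) (𝓝[<] 1) (𝓝 S) := by
    have : Continuous fun t : ℝ => t * S := by fun_prop
    simpa using (this.tendsto 1).mono_left nhdsWithin_le_nhds
  exact le_of_tendsto hlim (Filter.mem_of_superset (Ioo_mem_nhdsLT zero_lt_one) key)

theorem sum_sq_inner_mul_halfWidth_le {B₁ B₂ : RectBox N} (h : B₁.domain ⊆ B₂.domain)
    (i : Fin N) : ∑ j, ⟪B₂.axes i, B₁.axes j⟫_ℝ ^ 2 * B₁.halfWidth j ≤ B₂.halfWidth i := by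
  refine (Finset.sum_le_sum fun j _ => ?_).trans (sum_abs_inner_mul_halfWidth_le h i)
  have h1 : |⟪B₂.axes i, B₁.axes j⟫_ℝ| ≤ 1 := by
    simpa using abs_real_inner_le_norm (B₂.axes i) (B₁.axes j)
  have h2 := B₁.halfWidth_pos j
  rw [← sq_abs]
  gcongr
  exact pow_le_of_le_one (abs_nonneg _) h1 two_ne_zero

end RectBox

theorem fundamentalRobinEigenvalue_anti (hβ : 0 ≤ β) {B₁ B₂ : RectBox N}
    (h : B₁.domain ⊆ B₂.domain) :
    fundamentalRobinEigenvalue β B₂ ≤ fundamentalRobinEigenvalue β B₁ := by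
  rw [fundamentalRobinEigenvalue_eq hβ, fundamentalRobinEigenvalue_eq hβ]
  calc ∑ i, robinMu β (B₂.halfWidth i) ^ 2
      ≤ ∑ i, ∑ j, ⟪B₂.axes i, B₁.axes j⟫_ℝ ^ 2 * robinMu β (B₁.halfWidth j) ^ 2 :=
        Finset.sum_le_sum fun i _ => robinMu_sq_le_sum hβ (B₂.halfWidth_pos i) B₁.halfWidth_pos
          -- Unit row sums provide the Jensen weights; unit column sums collapse the double sum
          -- below.
          (fun _ => sq_nonneg _) (by rw [B₁.axes.sum_sq_inner_left]; simp)
          (sum_sq_inner_mul_halfWidth_le h i)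
    _ = ∑ j, robinMu β (B₁.halfWidth j) ^ 2 := by
        rw [Finset.sum_comm]
        refine Finset.sum_congr rfl fun j _ => ?_
        rw [← Finset.sum_mul, B₂.axes.sum_sq_inner_right]
        simp

theorem mainTheorem11 (N : ℕ) (hN : 1 ≤ N) (β : ℝ) (hβ : 0 ≤ β) :
    StrictAntiOn (robinMu β) (Set.Ioi 0) ∧
    (∀ B : RectBox N,
      IsLeast (robinEigenvalues β B) (fundamentalRobinEigenvalue β B) ∧
      fundamentalRobinEigenvalue β B = ∑ j, robinMu β (B.halfWidth j) ^ 2) ∧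
    (∀ B₁ B₂ : RectBox N, B₁.domain ⊆ B₂.domain →
      fundamentalRobinEigenvalue β B₂ ≤ fundamentalRobinEigenvalue β B₁) := by
  refine ⟨strictAntiOn_robinMu hβ, fun B => ⟨?_, fundamentalRobinEigenvalue_eq hβ B⟩,
    fun B₁ B₂ h => fundamentalRobinEigenvalue_anti hβ h⟩
  rw [fundamentalRobinEigenvalue_eq hβ]
  exact isLeast_robinEigenvalues hβ B
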